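/- Let $(\Omega,\mathcal A,P)$ be a probability space and let $(X_t)_{t\in\mathbb Z}$ be a classical stochastic volatility model: $X_t=\sigma_t\epsilon_t$, where $\sigma_t>0$ almost surely and $$\log\sigma_t=\sum_{i=0}^\infty a_i\,\eta_{t-i}\quad\text{(partial sums converging almost surely)},\qquad t\in\mathbb Z,$$ with real coefficients $a_i$ and i.i.d. normally distributed $\eta_t$, $t\in\mathbb Z$ (variance zero allowed), and where $\epsilon_t$, $t\in\mathbb Z$, are i.i.d., the sequence $(\epsilon_t)$ is independent of the sequence $(\eta_t)$, and for some $\alpha>0$ and $p\in(0,1]$, for all $s>0$, $$\frac{P(\epsilon_t>sx)}{P(|\epsilon_t|>x)}\to p\,s^{-\alpha},\qquad \frac{P(\epsilon_t<-sx)}{P(|\epsilon_t|>x)}\to(1-p)\,s^{-\alpha},\qquad x\to\infty.$$ A random vector $Z$ in $\mathbb R^d$ is called regularly varying on $\mathbb E^d=(0,\infty)^d$ with limit measure $\nu$ and index $-\kappa<0$ if $P(\min_i Z_i>x)>0$ for all $x$, $\nu\neq0$ is a measure on the Borel sets of $\mathbb E^d$ that is finite on $(x,\infty)^d$ for every $x>0$,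 $$\frac{P(Z\in xB)}{P(\min_i Z_i>x)}\to\nu(B),\qquad x\to\infty,$$ for all Borel sets $B\subset\mathbb E^d$ bounded away from the boundary of $\mathbb E^d$ with $\nu(\partial B)=0$, and $\nu(cB)=c^{-\kappa}\nu(B)$ for all $c>0$ and all Borel sets $B\subset\mathbb E^d$. Then: (i) For every $d\ge1$ and all pairwise distinct $t_1,\dots,t_d\in\mathbb Z$, the vector $(X_{t_1},\dots,X_{t_d})$ is regularly varying on $(0,\infty)^d$ with index $-d\alpha$ and a limit measure $\nu$ satisfying $$\nu\big((s_1,\infty)\times\dots\times(s_d,\infty)\big)=\prod_{i=1}^d s_i^{-\alpha}\qquad\text{for all }s_1,\dots,s_d>0.$$ A random vector with independent components and the same marginal distributions as $X_{t_1},\dots,X_{t_d}$ is also regularly varying on $(0,\infty)^d$, with the same index and the same limit measure $\nu$. (ii) For every $t\in\mathbb Z$ and every lag $h\ge1$, the pair $(X_t,X_{t+h})$ has coefficient of tail dependence $1/2$: $X_t$ and $X_{t+h}$ have the same distribution function $F$, and, with $F^{\leftarrow}(u)=\inf\{x: F(x)\ge u\}$, the function $x\mapsto P\big(X_t>F^{\leftarrow}(1-1/x),\,X_{t+h}>F^{\leftarrow}(1-1/x)\big)$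 is regularly varying at infinity with index $-2$. -/

import Mathlib

open MeasureTheory ProbabilityTheory Filter Topology Set
open scoped Pointwise

/-- The open cone `(0, ∞)^d` in `ℝ^d`. -/
def posCone (d : ℕ) : Set (Fin d → ℝ) := {y | ∀ i, 0 < y i}

/-- `B` is contained in `(0, ∞)^d` and bounded away from the boundary of that cone. The distance
of a point of the cone to the boundary (or to the complement) of the cone is its smallest
coordinate, so this means that the smallest coordinate is bounded below on `B` by some `δ > 0`. -/
def BoundedAwayFromAxes {d : ℕ} (B : Set (Fin d → ℝ)) : Prop :=
  ∃ δ : ℝ, 0 < δ ∧ ∀ y ∈ B, ∀ i, δ ≤ y i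

/-- The random vector `Z` is regularly varying on the cone `(0, ∞)^d` with index `κ` (a negative
number in all uses) and limit measure `ν`. A measure on the Borel sets of `(0, ∞)^d` is represented
by a measure on `ℝ^d` that vanishes outside the cone; `∀ i, x < Z ω i` says `min (Z ω) > x`. -/
structure IsRegVaryingOnCone {Ω : Type*} [MeasurableSpace Ω] (P : Measure Ω) {d : ℕ}
    (Z : Ω → Fin d → ℝ) (κ : ℝ) (ν : Measure (Fin d → ℝ)) : Prop where
  null_compl : ν (posCone d)ᶜ = 0
  ne_zero : ν ≠ 0
  finite : ∀ x : ℝ, 0 < x → ν {y | ∀ i, x < y i} < ⊤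
  tail_pos : ∀ x : ℝ, 0 < P {ω | ∀ i, x < Z ω i}
  tendsto : ∀ B : Set (Fin d → ℝ), MeasurableSet B → BoundedAwayFromAxes B →
    ν (frontier B) = 0 →
    Tendsto (fun x : ℝ => P {ω | Z ω ∈ x • B} / P {ω | ∀ i, x < Z ω i}) atTop (𝓝 (ν B))
  homogeneous : ∀ c : ℝ, 0 < c → ∀ B : Set (Fin d → ℝ), MeasurableSet B → B ⊆ posCone d →
    ν (c • B) = ENNReal.ofReal (c ^ κ) * ν B

/-- The real function `f` is regularly varying at infinity with index `ρ`: it is positive and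
measurable on a neighbourhood of infinity, and `f (s x) / f x → s ^ ρ` for every `s > 0`. -/
def IsRegVaryingAtTop (f : ℝ → ℝ) (ρ : ℝ) : Prop :=
  (∃ A : ℝ, (∀ x, A < x → 0 < f x) ∧ Measurable (fun x : Ioi A => f x)) ∧
    ∀ s : ℝ, 0 < s → Tendsto (fun x => f (s * x) / f x) atTop (𝓝 (s ^ ρ))

/-- The quantile function `F^←(u) = inf {x | F x ≥ u}`, `0 < u < 1`, of a law `μ` on `ℝ` with
distribution function `F`. -/
noncomputable def quantileFun (μ : Measure ℝ) (u : ℝ) : ℝ := sInf {x : ℝ | u ≤ cdf μ x}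

/-- `(Y₀, Y₁)`, with equal marginal laws, has coefficient of tail dependence `η`: the function
`x ↦ P(Y₀ > F^←(1 - 1/x), Y₁ > F^←(1 - 1/x))` is regularly varying with index `-1/η`. -/
def HasTailDependenceCoeff {Ω : Type*} [MeasurableSpace Ω] (P : Measure Ω)
    (Y₀ Y₁ : Ω → ℝ) (η : ℝ) : Prop :=
  IdentDistrib Y₀ Y₁ P P ∧
    IsRegVaryingAtTop
      (fun x => P.real {ω | quantileFun (P.map Y₀) (1 - 1 / x) < Y₀ ω ∧
        quantileFun (P.map Y₀) (1 - 1 / x) < Y₁ ω}) (-1 / η)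

/-- The classical stochastic volatility model `X t = σ t * ε t`, with Gaussian linear
log-volatility `log (σ t) = ∑ i, a i * η (t - i)` (almost surely convergent) driven by i.i.d.
`N(m, v)` variables `η t`, and i.i.d. innovations `ε t`, independent of the sequence `η`, whose
tails are regularly varying with index `-α` and balance parameter `p`. -/
structure IsClassicalSVModel {Ω : Type*} [MeasurableSpace Ω] (P : Measure Ω)
    (X σ ε η : ℤ → Ω → ℝ) (a : ℕ → ℝ) (m : ℝ) (v : NNReal) (α p : ℝ) : Prop where
  measurable_vol : ∀ t, Measurable (σ t)
  measurable_innov : ∀ t, Measurable (ε t)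
  measurable_noise : ∀ t, Measurable (η t)
  returns_eq : ∀ t ω, X t ω = σ t ω * ε t ω
  vol_pos : ∀ t, ∀ᵐ ω ∂P, 0 < σ t ω
  log_vol : ∀ t : ℤ, ∀ᵐ ω ∂P,
    Tendsto (fun n : ℕ => ∑ i ∈ Finset.range n, a i * η (t - (i : ℤ)) ω) atTop
      (𝓝 (Real.log (σ t ω)))
  noise_law : ∀ t, P.map (η t) = gaussianReal m v
  noise_indep : iIndepFun η P
  innov_indep : iIndepFun ε P
  innov_identDistrib : ∀ t, IdentDistrib (ε t) (ε 0) P P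
  innov_indep_noise : IndepFun (fun ω t => ε t ω) (fun ω t => η t ω) P
  right_tail : ∀ t, ∀ s : ℝ, 0 < s →
    Tendsto (fun x : ℝ => P.real {ω | s * x < ε t ω} / P.real {ω | x < |ε t ω|}) atTop
      (𝓝 (p * s ^ (-α)))
  left_tail : ∀ t, ∀ s : ℝ, 0 < s →
    Tendsto (fun x : ℝ => P.real {ω | ε t ω < -(s * x)} / P.real {ω | x < |ε t ω|}) atTop
      (𝓝 ((1 - p) * s ^ (-α)))

/-! ### Weak convergence from upper orthants -/

/-! Conditionally on the volatilities the returns are independent, so with `G` the right tail of `ε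
0`, `P(X (t i) > x * s i for all i) = E ∏ G(x * s i / σ (t i))` (`measureReal_forall_lt_mul`).
Divided by `G x ^ d`, the integrand tends to `∏ (s i / σ (t i)) ^ (-α)`. A Potter bound dominates it
by a polynomial in the volatilities, which have all moments because `log σ` is an almost sure limit
of Gaussian variables (`integrable_exp_mul_of_ae_tendsto_gaussian`). Hence the joint tail is
asymptotic to `G x ^ d * (∏ s i ^ (-α)) * K` with `K = E ∏ σ (t i) ^ α`
(`exists_tendsto_joint_tail`). All dependence between the volatilities sits in `K`, which cancels on
normalization; this is why the limit is the same as for independent components.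

Convergence on orthants extends to Borel sets bounded away from the axes by conditioning on a large
orthant and using weak convergence of the resulting probability measures
(`tendsto_measure_smul_div_of_tendsto_pi_Ioi`).

For the tail dependence coefficient, the joint exceedance probability is asymptotic to a constant
times the squared marginal tail. That tail at the quantile of level `1 - 1/x` is asymptotic to
`1/x`, even if `F` has jumps, so the composite decays like a constant times `x ^ (-2)`. -/

theorem tendsto_measureReal_pi_Ioc_or_Ioi {ι κ : Type*} [Fintype ι] [DecidableEq ι] {l : Filter κ}
    {μ : κ → Measure (ι → ℝ)} [∀ k, IsFiniteMeasure (μ k)] {ν : Measure (ι → ℝ)}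
    [IsFiniteMeasure ν]
    (h : ∀ s : ι → ℝ, Tendsto (fun k => (μ k).real (univ.pi fun i => Ioi (s i))) l
      (𝓝 (ν.real (univ.pi fun i => Ioi (s i)))))
    (J : Finset ι) : ∀ a b : ι → ℝ, (∀ i, a i ≤ b i) →
      Tendsto (fun k => (μ k).real (univ.pi fun i => if i ∈ J then Ioc (a i) (b i) else Ioi (a i)))
        l (𝓝 (ν.real (univ.pi fun i => if i ∈ J then Ioc (a i) (b i) else Ioi (a i)))) := by
  induction J using Finset.induction_on with
  | empty => intro a b _; simpa using h a
  | insert j J hj ih =>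
    intro a b hab
    -- Bounding coordinate `j` from above removes from `R a` the box whose `j`-th lower corner is
    -- raised to `b j`. Both boxes are covered by the induction hypothesis, so their masses
    -- subtract.
    set a' := Function.update a j (b j) with ha'
    have hab' : ∀ i, a' i ≤ b i := by
      intro i
      by_cases hij : i = j
      · subst hij; simp [ha']
      · simpa [ha', hij] using hab i
    set R : (ι → ℝ) → Set (ι → ℝ) := fun c =>
      univ.pi fun i => if i ∈ J then Ioc (c i) (b i) else Ioi (c i) with hR
    have hmeas : ∀ c, MeasurableSet (R c) := fun c =>
      MeasurableSet.univ_pi fun i => by split_ifs <;> measurability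
    have hsub : R a' ⊆ R a := by
      intro y hy i _
      have := hy i (mem_univ i)
      by_cases hij : i = j
      · subst hij
        simp only [hj, ↓reduceIte, ha', Function.update_self, mem_Ioi] at this ⊢
        exact (hab i).trans_lt this
      · simpa [ha', hij] using this
    have hset : (univ.pi fun i => if i ∈ insert j J then Ioc (a i) (b i) else Ioi (a i))
        = R a \ R a' := by
      ext y
      constructor
      · intro hy
        refine ⟨fun i _ => ?_, fun hy' => ?_⟩
        · have := hy i (mem_univ i)
          by_cases hij : i = j
          · subst hij
            simp only [Finset.mem_insert_self, ↓reduceIte, hj, mem_Ioi] at this ⊢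
            exact this.1
          · simpa [hij] using this
        · have h1 := hy j (mem_univ j)
          have h2 := hy' j (mem_univ j)
          simp only [Finset.mem_insert_self, ↓reduceIte, hj, ha', Function.update_self,
            mem_Ioi] at h1 h2
          exact absurd h1.2 (not_le.2 h2)
      · rintro ⟨hy, hy'⟩ i -
        have := hy i (mem_univ i)
        by_cases hij : i = j
        · subst hij
          simp only [Finset.mem_insert_self, ↓reduceIte, hj, mem_Ioi] at this ⊢
          refine ⟨this, not_lt.1 fun hlt => hy' fun k _ => ?_⟩
          by_cases hk : k = i
          · subst hk; simpa [hj, ha'] using hlt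
          · simpa [ha', hk] using hy k (mem_univ k)
        · simpa [hij] using this
    rw [hset]
    have hd : ∀ (ρ : Measure (ι → ℝ)) [IsFiniteMeasure ρ],
        ρ.real (R a \ R a') = ρ.real (R a) - ρ.real (R a') := fun ρ _ =>
      measureReal_sdiff hsub (hmeas a')
    simp_rw [hd]
    exact (ih a b hab).sub (ih a' b hab')

/-- Probability measures on `ℝ^ι` converge weakly if the masses of all upper orthants converge. -/
theorem tendsto_probabilityMeasure_of_tendsto_pi_Ioi {ι κ : Type*} [Fintype ι] {l : Filter κ}
    [l.IsCountablyGenerated] {μ : κ → ProbabilityMeasure (ι → ℝ)} {ν : ProbabilityMeasure (ι → ℝ)}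
    (h : ∀ s : ι → ℝ, Tendsto (fun k => (μ k : Measure (ι → ℝ)).real (univ.pi fun i => Ioi (s i))) l
      (𝓝 ((ν : Measure (ι → ℝ)).real (univ.pi fun i => Ioi (s i))))) :
    Tendsto μ l (𝓝 ν) := by
  classical
  let S : Set (Set (ι → ℝ)) := {t | ∃ a b : ι → ℝ, t = univ.pi fun i => Ioc (a i) (b i)}
  have hS : IsPiSystem S := by
    rintro - ⟨a, b, rfl⟩ - ⟨a', b', rfl⟩ -
    exact ⟨fun i => a i ⊔ a' i, fun i => b i ⊓ b' i, by
      rw [← pi_inter_distrib]; simp only [Ioc_inter_Ioc]⟩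
  apply hS.tendsto_probabilityMeasure_of_tendsto_of_mem
  · rintro - ⟨a, b, rfl⟩
    exact MeasurableSet.univ_pi fun i => measurableSet_Ioc
  · intro u hu x hx
    obtain ⟨r, hr, hru⟩ := Metric.isOpen_iff.1 hu x hx
    refine ⟨_, ⟨fun i => x i - r / 2, fun i => x i + r / 2, rfl⟩, ?_, ?_⟩
    · exact set_pi_mem_nhds finite_univ fun i _ =>
        Ioc_mem_nhds (by linarith) (by linarith)
    · refine subset_trans ?_ hru
      rw [ball_pi _ hr]
      intro y hy i _
      have := hy i (mem_univ i)
      simp only [mem_Ioc] at this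
      rw [Metric.mem_ball, Real.dist_eq, abs_lt]
      constructor <;> linarith [this.1, this.2]
  · rintro - ⟨a, b, rfl⟩
    rw [← NNReal.tendsto_coe]
    by_cases hab : ∀ i, a i ≤ b i
    · simpa using tendsto_measureReal_pi_Ioc_or_Ioi h Finset.univ a b hab
    · push Not at hab
      obtain ⟨i, hi⟩ := hab
      have : (univ.pi fun i => Ioc (a i) (b i)) = ∅ :=
        univ_pi_eq_empty (Ioc_eq_empty (not_lt.2 hi.le))
      simpa [this] using tendsto_const_nhds

/-! ### The homogeneous product measure on the cone -/

/-- The measure on `(0, ∞)` with `ν (s, ∞) = s ^ (-α)`. -/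
noncomputable def powerTailMeasure (α : ℝ) : Measure ℝ :=
  (volume.restrict (Ioi 0)).withDensity fun x => ENNReal.ofReal (α * x ^ (-α - 1))

instance (α : ℝ) : SigmaFinite (powerTailMeasure α) :=
  SigmaFinite.withDensity_ofReal _

theorem powerTailMeasure_Ioi {α s : ℝ} (hα : 0 < α) (hs : 0 < s) :
    powerTailMeasure α (Ioi s) = ENNReal.ofReal (s ^ (-α)) := by
  rw [powerTailMeasure, withDensity_apply _ measurableSet_Ioi,
    Measure.restrict_restrict measurableSet_Ioi, inter_eq_left.2 (Ioi_subset_Ioi hs.le),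
    ← ofReal_integral_eq_lintegral_ofReal]
  · rw [integral_const_mul, integral_Ioi_rpow_of_lt (by linarith) hs]
    congr 1
    have : -α - 1 + 1 = -α := by ring
    rw [this]
    field_simp
  · exact ((integrableOn_Ioi_rpow_of_lt (by linarith) hs).const_mul α)
  · filter_upwards [ae_restrict_mem measurableSet_Ioi] with x hx
    have : (0 : ℝ) < x := hs.trans hx
    positivity

theorem powerTailMeasure_Iic_zero (α : ℝ) : powerTailMeasure α (Iic 0) = 0 := by
  refine withDensity_absolutelyContinuous _ _ ?_
  rw [Measure.restrict_apply measurableSet_Iic, Iic_inter_Ioi, Ioc_self, measure_empty]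

/-- The product measure on `(0, ∞)^d` with marginals `powerTailMeasure α`. -/
noncomputable def coneMeasure (d : ℕ) (α : ℝ) : Measure (Fin d → ℝ) :=
  Measure.pi fun _ => powerTailMeasure α

theorem coneMeasure_pi_Ioi {d : ℕ} {α : ℝ} (hα : 0 < α) {s : Fin d → ℝ} (hs : ∀ i, 0 < s i) :
    coneMeasure d α (univ.pi fun i => Ioi (s i)) = ENNReal.ofReal (∏ i, s i ^ (-α)) := by
  rw [coneMeasure, Measure.pi_pi, ENNReal.ofReal_prod_of_nonneg]
  · exact Finset.prod_congr rfl fun i _ => powerTailMeasure_Ioi hα (hs i)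
  · exact fun i _ => (Real.rpow_pos_of_pos (hs i) _).le

theorem coneMeasure_compl_posCone (d : ℕ) (α : ℝ) : coneMeasure d α (posCone d)ᶜ = 0 := by
  have : (posCone d)ᶜ ⊆ ⋃ i, (fun y : Fin d → ℝ => y i) ⁻¹' Iic 0 := by
    intro y hy
    simpa [posCone] using hy
  refine measure_mono_null this (measure_iUnion_null fun i => ?_)
  exact (Measure.quasiMeasurePreserving_eval (fun _ : Fin d => powerTailMeasure α) i).preimage_null
    (powerTailMeasure_Iic_zero α)

theorem generateFrom_pi_Ioi (d : ℕ) :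
    (MeasurableSpace.pi : MeasurableSpace (Fin d → ℝ)) =
      MeasurableSpace.generateFrom {t | ∃ s : Fin d → ℝ, t = univ.pi fun i => Ioi (s i)} := by
  have h := generateFrom_eq_pi (ι := Fin d) (α := fun _ => ℝ) (C := fun _ => range Ioi)
    (fun _ => by rw [← borel_eq_generateFrom_Ioi]; exact (BorelSpace.measurable_eq).symm)
    (fun _ => ⟨fun n : ℕ => Ioi (-(n : ℝ)), fun n => mem_range_self _, by
      refine eq_univ_of_forall fun x => mem_iUnion.2 ?_
      obtain ⟨n, hn⟩ := exists_nat_gt (-x)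
      exact ⟨n, by simp only [mem_Ioi]; linarith⟩⟩)
  rw [← h]
  congr 1
  ext t
  constructor
  · rintro ⟨u, hu, rfl⟩
    choose s hs using fun i => hu i (mem_univ i)
    exact ⟨s, by simp only [hs]⟩
  · rintro ⟨s, rfl⟩
    exact ⟨fun i => Ioi (s i), fun i _ => mem_range_self _, rfl⟩

theorem isPiSystem_pi_Ioi (d : ℕ) :
    IsPiSystem {t : Set (Fin d → ℝ) | ∃ s : Fin d → ℝ, t = univ.pi fun i => Ioi (s i)} := by
  rintro - ⟨a, rfl⟩ - ⟨a', rfl⟩ -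
  exact ⟨fun i => a i ⊔ a' i, by rw [← pi_inter_distrib]; simp only [Ioi_inter_Ioi]⟩

/-- Measures that are finite and agree on the orthants `∏ (s i, ∞)`, `s i > 0`, agree on the
measurable subsets of the cone. -/
theorem measure_eq_of_forall_pi_Ioi {d : ℕ} {μ ν : Measure (Fin d → ℝ)}
    (hfin : ∀ s : Fin d → ℝ, (∀ i, 0 < s i) → μ (univ.pi fun i => Ioi (s i)) ≠ ⊤)
    (h : ∀ s : Fin d → ℝ, (∀ i, 0 < s i) →
      μ (univ.pi fun i => Ioi (s i)) = ν (univ.pi fun i => Ioi (s i)))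
    {B : Set (Fin d → ℝ)} (hB : MeasurableSet B) (hBc : B ⊆ posCone d) : μ B = ν B := by
  -- These orthants exhaust the cone. On each the measures are finite, and intersecting one with an
  -- arbitrary orthant gives an orthant with positive corner, so the π-system uniqueness theorem
  -- applies.
  let A : ℕ → Set (Fin d → ℝ) := fun n => univ.pi fun _ => Ioi (1 / ((n : ℝ) + 1))
  have hpos : ∀ n : ℕ, (0 : ℝ) < 1 / ((n : ℝ) + 1) := fun n => by positivity
  have hA : ∀ n, MeasurableSet (A n) := fun n => MeasurableSet.univ_pi fun _ => measurableSet_Ioi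
  have hres : ∀ n, μ.restrict (A n) = ν.restrict (A n) := by
    intro n
    have : IsFiniteMeasure (μ.restrict (A n)) :=
      ⟨by rw [Measure.restrict_apply_univ]; exact (hfin _ fun _ => hpos n).lt_top⟩
    refine ext_of_generate_finite _ (generateFrom_pi_Ioi d) (isPiSystem_pi_Ioi d) ?_ ?_
    · rintro - ⟨s, rfl⟩
      have hm : MeasurableSet (univ.pi fun i => Ioi (s i)) :=
        MeasurableSet.univ_pi fun _ => measurableSet_Ioi
      rw [Measure.restrict_apply hm, Measure.restrict_apply hm, ← pi_inter_distrib]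
      simp only [Ioi_inter_Ioi]
      exact h _ fun i => lt_sup_of_lt_right (hpos n)
    · rw [Measure.restrict_apply_univ, Measure.restrict_apply_univ]
      exact h _ fun i => hpos n
  have hmono : Monotone fun n => B ∩ A n := by
    intro n k hnk
    refine inter_subset_inter_right _ (pi_mono fun i _ => Ioi_subset_Ioi ?_)
    exact one_div_le_one_div_of_le (by positivity) (by exact_mod_cast Nat.succ_le_succ hnk)
  have hU : B = ⋃ n, B ∩ A n := by
    rw [← inter_iUnion]
    refine (inter_eq_left.2 fun y hy => mem_iUnion.2 ?_).symm
    have hy' : ∀ i, 0 < y i := hBc hy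
    have : ∀ᶠ n : ℕ in atTop, ∀ i, 1 / ((n : ℝ) + 1) < y i :=
      eventually_all.2 fun i =>
        (tendsto_one_div_add_atTop_nhds_zero_nat (𝕜 := ℝ)).eventually_lt_const (hy' i)
    obtain ⟨n, hn⟩ := this.exists
    exact ⟨n, fun i _ => hn i⟩
  rw [hU, hmono.measure_iUnion, hmono.measure_iUnion]
  refine iSup_congr fun n => ?_
  rw [← Measure.restrict_apply hB, ← Measure.restrict_apply hB, hres n]

/-- On an orthant each of the `d` coordinates contributes a factor `c ^ (-α)`; uniqueness on the
cone carries this over to all measurable subsets. -/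
theorem coneMeasure_smul {d : ℕ} {α : ℝ} (hα : 0 < α) {c : ℝ} (hc : 0 < c)
    {B : Set (Fin d → ℝ)} (hB : MeasurableSet B) (hBc : B ⊆ posCone d) :
    coneMeasure d α (c • B) = ENNReal.ofReal (c ^ (-((d : ℝ) * α))) * coneMeasure d α B := by
  have hmeas : Measurable fun y : Fin d → ℝ => c⁻¹ • y := measurable_const_smul _
  have hpre : c • B = (fun y : Fin d → ℝ => c⁻¹ • y) ⁻¹' B := by
    ext y
    rw [mem_smul_set_iff_inv_smul_mem₀ hc.ne', mem_preimage]
  rw [hpre, ← Measure.map_apply hmeas hB, ← smul_eq_mul, ← Measure.smul_apply]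
  have hbox : ∀ s : Fin d → ℝ, (∀ i, 0 < s i) →
      (coneMeasure d α).map (fun y => c⁻¹ • y) (univ.pi fun i => Ioi (s i)) =
        ENNReal.ofReal (∏ i, (c * s i) ^ (-α)) := by
    intro s hs
    rw [Measure.map_apply hmeas (MeasurableSet.univ_pi fun _ => measurableSet_Ioi),
      ← coneMeasure_pi_Ioi hα fun i => mul_pos hc (hs i)]
    congr 1
    ext y
    simp only [mem_preimage, mem_univ_pi, Pi.smul_apply, smul_eq_mul, mem_Ioi]
    exact forall_congr' fun i => lt_inv_mul_iff₀ hc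
  refine measure_eq_of_forall_pi_Ioi (fun s hs => ?_) (fun s hs => ?_) hB hBc
  · rw [hbox s hs]; exact ENNReal.ofReal_ne_top
  · rw [hbox s hs, Measure.smul_apply, coneMeasure_pi_Ioi hα hs, smul_eq_mul,
      ← ENNReal.ofReal_mul (Real.rpow_pos_of_pos hc _).le]
    congr 1
    simp_rw [fun i => Real.mul_rpow (z := -α) hc.le (hs i).le]
    rw [Finset.prod_mul_distrib, Finset.prod_const, Finset.card_univ, Fintype.card_fin,
      ← Real.rpow_natCast, ← Real.rpow_mul hc.le]
    congr 2
    ring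

/-! ### A criterion for regular variation on the cone -/

/-- Conditioning on `Z ∈ x • A`, for an orthant `A` containing `B`, replaces the infinite limit
measure by a probability measure. Convergence on orthants then gives weak convergence, the
portmanteau theorem handles `B`, and multiplying by the normalized mass of `A` undoes the
conditioning. -/
theorem tendsto_measure_smul_div_of_tendsto_pi_Ioi {Ω : Type*} [MeasurableSpace Ω] {P : Measure Ω}
    [IsProbabilityMeasure P] {d : ℕ} {Z : Ω → Fin d → ℝ} (hZ : Measurable Z) {α : ℝ} (hα : 0 < α)
    (htail : ∀ x : ℝ, 0 < P {ω | ∀ i, x < Z ω i})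
    (h : ∀ s : Fin d → ℝ, (∀ i, 0 < s i) →
      Tendsto (fun x : ℝ => P.real {ω | ∀ i, x * s i < Z ω i} / P.real {ω | ∀ i, x < Z ω i}) atTop
        (𝓝 (∏ i, s i ^ (-α))))
    {B : Set (Fin d → ℝ)} (hB : MeasurableSet B) (hBa : BoundedAwayFromAxes B)
    (hBf : coneMeasure d α (frontier B) = 0) :
    Tendsto (fun x : ℝ => P {ω | Z ω ∈ x • B} / P {ω | ∀ i, x < Z ω i}) atTop
      (𝓝 (coneMeasure d α B)) := by
  obtain ⟨δ, hδ, hBδ⟩ := hBa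
  -- The orthant `A` is open while `B` may touch level `δ`, so its corner must lie strictly below
  -- `δ`.
  set e := δ / 2 with he
  have he0 : 0 < e := by positivity
  set A : Set (Fin d → ℝ) := univ.pi fun _ => Ioi e with hAdef
  have hA : MeasurableSet A := MeasurableSet.univ_pi fun _ => measurableSet_Ioi
  have hBA : B ⊆ A := fun y hy i _ => lt_of_lt_of_le (by simp only [he]; linarith) (hBδ y hy i)
  have hνA : coneMeasure d α A = ENNReal.ofReal (∏ _i : Fin d, e ^ (-α)) :=
    coneMeasure_pi_Ioi hα fun _ => he0
  have hcpos : 0 < ∏ _i : Fin d, e ^ (-α) :=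
    Finset.prod_pos fun _ _ => Real.rpow_pos_of_pos he0 _
  set c := ∏ _i : Fin d, e ^ (-α) with hc
  have hνA0 : coneMeasure d α A ≠ 0 := by rw [hνA]; simpa using hcpos
  have hνAt : coneMeasure d α A ≠ ⊤ := by rw [hνA]; exact ENNReal.ofReal_ne_top
  set T : ℝ → Set Ω := fun x => {ω | ∀ i, x * e < Z ω i} with hTdef
  have hbox : ∀ s : Fin d → ℝ, MeasurableSet {ω | ∀ i, s i < Z ω i} := fun s => by
    have : {ω | ∀ i, s i < Z ω i} = Z ⁻¹' (univ.pi fun i => Ioi (s i)) := by ext; simp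
    rw [this]
    exact hZ (MeasurableSet.univ_pi fun _ => measurableSet_Ioi)
  have hT : ∀ x, MeasurableSet (T x) := fun x => hbox fun _ => x * e
  have hT0 : ∀ x, P (T x) ≠ 0 := fun x => (htail (x * e)).ne'
  have hTr : ∀ x, 0 < P.real (T x) := fun x =>
    ENNReal.toReal_pos (hT0 x) (measure_ne_top _ _)
  have hDr : ∀ x, 0 < P.real {ω | ∀ i, x < Z ω i} := fun x =>
    ENNReal.toReal_pos (htail x).ne' (measure_ne_top _ _)
  have hmul : ∀ x : ℝ, Measurable fun ω => x⁻¹ • Z ω := fun x => (measurable_const_smul x⁻¹).comp hZ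
  have hcP : ∀ x, IsProbabilityMeasure (P[|T x]) := fun x => cond_isProbabilityMeasure (hT0 x)
  let μ : ℝ → ProbabilityMeasure (Fin d → ℝ) := fun x =>
    ⟨(P[|T x]).map (fun ω => x⁻¹ • Z ω), Measure.isProbabilityMeasure_map (hmul x).aemeasurable⟩
  let ν : ProbabilityMeasure (Fin d → ℝ) :=
    ⟨(coneMeasure d α)[|A], cond_isProbabilityMeasure_of_finite hνA0 hνAt⟩
  have hμ : ∀ x, ∀ E : Set (Fin d → ℝ), MeasurableSet E → (μ x : Measure (Fin d → ℝ)).real E =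
      P.real (T x ∩ {ω | x⁻¹ • Z ω ∈ E}) / P.real (T x) := by
    intro x E hE
    change ((P[|T x]).map (fun ω => x⁻¹ • Z ω) E).toReal = _
    rw [Measure.map_apply (hmul x) hE, cond_apply (hT x), ENNReal.toReal_mul, ENNReal.toReal_inv,
      div_eq_inv_mul]
    rfl
  have hν : ∀ E : Set (Fin d → ℝ), (ν : Measure (Fin d → ℝ)).real E =
      (coneMeasure d α (A ∩ E)).toReal / c := by
    intro E
    change ((coneMeasure d α)[|A] E).toReal = _
    rw [cond_apply hA, ENNReal.toReal_mul, ENNReal.toReal_inv, div_eq_inv_mul, hνA,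
      ENNReal.toReal_ofReal hcpos.le]
  have hTlim := h (fun _ => e) fun _ => he0
  have hlim : Tendsto μ atTop (𝓝 ν) := by
    refine tendsto_probabilityMeasure_of_tendsto_pi_Ioi fun s => ?_
    -- Weak convergence needs every real corner `s`, but inside `A` only `e ⊔ s` matters, and it is
    -- positive.
    have hm0 : ∀ i, 0 < e ⊔ s i := fun i => lt_sup_of_lt_left he0
    have h1 : (ν : Measure (Fin d → ℝ)).real (univ.pi fun i => Ioi (s i)) =
        (∏ i, (e ⊔ s i) ^ (-α)) / c := by
      rw [hν, hAdef, ← pi_inter_distrib]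
      simp only [Ioi_inter_Ioi]
      rw [coneMeasure_pi_Ioi hα hm0, ENNReal.toReal_ofReal]
      exact Finset.prod_nonneg fun i _ => (Real.rpow_pos_of_pos (hm0 i) _).le
    rw [h1]
    refine ((h _ hm0).div hTlim hcpos.ne').congr' ?_
    filter_upwards [eventually_gt_atTop 0] with x hx
    rw [hμ x _ (MeasurableSet.univ_pi fun _ => measurableSet_Ioi),
      Pi.div_apply, div_div_div_cancel_right₀ (hDr x).ne']
    congr 2
    ext ω
    simp only [mem_ofPred_eq, hTdef, mem_inter_iff, mem_univ_pi, mem_Ioi, Pi.smul_apply,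
      smul_eq_mul, ← forall_and, lt_inv_mul_iff₀ hx]
    refine forall_congr' fun i => ?_
    rw [mul_max_of_nonneg _ _ hx.le, max_lt_iff]
  have hνf : (ν : Measure (Fin d → ℝ)) (frontier B) = 0 := cond_absolutelyContinuous hBf
  have hBlim : Tendsto (fun x => (μ x : Measure (Fin d → ℝ)).real B) atTop
      (𝓝 ((ν : Measure (Fin d → ℝ)).real B)) :=
    (ENNReal.tendsto_toReal (measure_ne_top _ _)).comp
      (ProbabilityMeasure.tendsto_measure_of_null_frontier_of_tendsto' hlim hνf)
  have hBt : coneMeasure d α B ≠ ⊤ := ((measure_mono hBA).trans_lt hνAt.lt_top).ne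
  have hfin : coneMeasure d α B =
      ENNReal.ofReal ((ν : Measure (Fin d → ℝ)).real B * c) := by
    rw [hν, inter_eq_right.2 hBA, div_mul_cancel₀ _ hcpos.ne', ENNReal.ofReal_toReal hBt]
  rw [hfin]
  refine (ENNReal.tendsto_ofReal (hBlim.mul hTlim)).congr' ?_
  filter_upwards [eventually_gt_atTop 0] with x hx
  have hset : T x ∩ {ω | x⁻¹ • Z ω ∈ B} = {ω | Z ω ∈ x • B} := by
    ext ω
    rw [mem_ofPred_eq, mem_smul_set_iff_inv_smul_mem₀ hx.ne']
    refine ⟨fun hω => hω.2, fun hω => ⟨fun i => ?_, hω⟩⟩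
    have := hBA hω i (mem_univ i)
    simpa [lt_inv_mul_iff₀ hx] using this
  rw [hμ x B hB, div_mul_div_cancel₀ (hTr x).ne', hset, ENNReal.ofReal_div_of_pos (hDr x)]
  simp [Measure.real]

theorem isRegVaryingOnCone_of_tendsto_pi_Ioi {Ω : Type*} [MeasurableSpace Ω] {P : Measure Ω}
    [IsProbabilityMeasure P] {d : ℕ} {Z : Ω → Fin d → ℝ} (hZ : Measurable Z) {α : ℝ} (hα : 0 < α)
    (htail : ∀ x : ℝ, 0 < P {ω | ∀ i, x < Z ω i})
    (h : ∀ s : Fin d → ℝ, (∀ i, 0 < s i) →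
      Tendsto (fun x : ℝ => P.real {ω | ∀ i, x * s i < Z ω i} / P.real {ω | ∀ i, x < Z ω i}) atTop
        (𝓝 (∏ i, s i ^ (-α)))) :
    IsRegVaryingOnCone P Z (-((d : ℝ) * α)) (coneMeasure d α) where
  null_compl := coneMeasure_compl_posCone d α
  ne_zero h0 := by
    have := coneMeasure_pi_Ioi (d := d) hα (s := fun _ => 1) fun _ => one_pos
    simp [h0] at this
  finite x hx := by
    have := coneMeasure_pi_Ioi (d := d) hα (s := fun _ => x) fun _ => hx
    have hset : (univ.pi fun _ : Fin d => Ioi x) = {y | ∀ i, x < y i} := by ext; simp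
    rw [← hset, this]
    exact ENNReal.ofReal_lt_top
  tail_pos := htail
  tendsto _ hB hBa hBf := tendsto_measure_smul_div_of_tendsto_pi_Ioi hZ hα htail h hB hBa hBf
  homogeneous _ hc _ hB hBc := coneMeasure_smul hα hc hB hBc

/-! ### A multivariate Breiman lemma -/

/-- A Potter type bound for an antitone tail function. -/
theorem exists_potter_bound {G : ℝ → ℝ} (hanti : Antitone G) (hpos : ∀ x, 0 < G x)
    (hle : ∀ x, G x ≤ 1) {α : ℝ}
    (h2 : Tendsto (fun x => G (2 * x) / G x) atTop (𝓝 (2 ^ (-α)))) :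
    ∃ (N : ℕ) (C x₀ : ℝ), 0 < C ∧ 0 < x₀ ∧
      ∀ x, x₀ ≤ x → ∀ y, 0 < y → G (x / y) / G x ≤ C * (1 + y ^ N) := by
  -- Since `N > α`, doubling the argument eventually costs at most a factor `2 ^ N`.
  obtain ⟨N, hN⟩ := exists_nat_gt α
  have hlt : ((2 : ℝ) ^ N)⁻¹ < 2 ^ (-α) := by
    rw [Real.rpow_neg zero_le_two, ← Real.rpow_natCast]
    exact inv_strictAnti₀ (by positivity) (Real.rpow_lt_rpow_of_exponent_lt one_lt_two hN)
  obtain ⟨x₁, hx₁⟩ := eventually_atTop.1 (h2.eventually_const_lt hlt)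
  set x₀ := max x₁ 1 with hx₀
  have hx₀1 : 1 ≤ x₀ := le_max_right _ _
  have hstep : ∀ x, x₀ ≤ x → G x ≤ 2 ^ N * G (2 * x) := by
    intro x hx
    have := hx₁ x ((le_max_left _ _).trans hx)
    rw [lt_div_iff₀ (hpos x), inv_mul_lt_iff₀ (by positivity)] at this
    exact this.le
  have hiter : ∀ k : ℕ, ∀ x, x₀ ≤ x → G x ≤ (2 ^ k) ^ N * G (2 ^ k * x) := by
    intro k
    induction k with
    | zero => intro x _; simp
    | succ k ih =>
      intro x hx
      have h2k : x₀ ≤ 2 ^ k * x :=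
        hx.trans (le_mul_of_one_le_left (by linarith) (one_le_pow₀ one_le_two))
      calc G x ≤ (2 ^ k) ^ N * G (2 ^ k * x) := ih x hx
        _ ≤ (2 ^ k) ^ N * (2 ^ N * G (2 * (2 ^ k * x))) := by gcongr; exact hstep _ h2k
        _ = (2 ^ (k + 1)) ^ N * G (2 ^ (k + 1) * x) := by
          rw [pow_succ, mul_pow, ← mul_assoc, mul_comm _ (2 : ℝ), ← mul_assoc]
  have hG0 := hpos x₀
  refine ⟨N, 1 + 2 ^ N / G x₀, x₀, by positivity, by linarith, fun x hx y hy => ?_⟩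
  have hx0 : 0 < x := by linarith
  rw [div_le_iff₀ (hpos x)]
  rcases le_total y 1 with hy1 | hy1
  · have h1 : G (x / y) ≤ G x := hanti (by rw [le_div_iff₀ hy]; nlinarith)
    have h3 : 1 ≤ (1 + 2 ^ N / G x₀) * (1 + y ^ N) :=
      one_le_mul_of_one_le_of_one_le (by simp; positivity) (by simp; positivity)
    exact h1.trans (le_mul_of_one_le_left (hpos x).le h3)
  · obtain ⟨k, hk1, hk2⟩ := exists_nat_pow_near hy1 one_lt_two
    -- The doubling bound holds only above `x₀`, hence the maximum; when `x / y` is below `x₀`, `G ≤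
    -- 1` pays for the change with a factor `1 / G x₀`. After `k + 1` doublings `w` has passed `x`,
    -- and `2 ^ (k + 1) ≤ 2 * y`.
    set w := max (x / y) x₀ with hw
    have hwx : x ≤ 2 ^ (k + 1) * w := by
      calc x = y * (x / y) := by field_simp
        _ ≤ 2 ^ (k + 1) * w := by
          gcongr
          exact le_max_left _ _
    have h1 : G w ≤ (2 * y) ^ N * G x := by
      refine (hiter (k + 1) w (le_max_right _ _)).trans ?_
      have := hpos (2 ^ (k + 1) * w)
      gcongr
      · rw [pow_succ]; linarith
      · exact hanti hwx
    have h3 : G (x / y) * G x₀ ≤ G w := by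
      rcases le_total (x / y) x₀ with h | h
      · rw [hw, max_eq_right h]
        exact mul_le_of_le_one_left hG0.le (hle _)
      · rw [hw, max_eq_left h]
        exact mul_le_of_le_one_right (hpos _).le (hle _)
    have h4 : G (x / y) ≤ 2 ^ N / G x₀ * y ^ N * G x := by
      rw [div_mul_eq_mul_div, div_mul_eq_mul_div, le_div_iff₀ hG0]
      calc _ ≤ (2 * y) ^ N * G x := h3.trans h1
        _ = _ := by rw [mul_pow]
    refine h4.trans ?_
    have := hpos x
    gcongr
    · linarith
    · linarith

/-- The `V i` may be dependent, so the product is bounded by the `Fintype.card ι`-th power of its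
largest factor, hence by the sum of these powers, whose terms are polynomials in a single `V i`. -/
theorem integrable_prod_one_add_pow {Ω ι : Type*} [MeasurableSpace Ω] {P : Measure Ω}
    [IsProbabilityMeasure P] [Fintype ι] {V : ι → Ω → ℝ} (hV : ∀ i, Measurable (V i))
    (hint : ∀ i (n : ℕ), Integrable (fun ω => V i ω ^ n) P)
    (hpos : ∀ᵐ ω ∂P, ∀ i, 0 < V i ω) (C : ℝ) (hC : 0 < C) (N : ℕ) {s : ι → ℝ}
    (hs : ∀ i, 0 < s i) :
    Integrable (fun ω => ∏ i, (C * (1 + (V i ω / s i) ^ N))) P := by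
  have hpow : ∀ i (n : ℕ), Integrable (fun ω => (C * (1 + (V i ω / s i) ^ N)) ^ n) P := by
    intro i n
    simp_rw [mul_pow, add_comm (1 : ℝ), add_pow, div_pow, one_pow, mul_one]
    refine (integrable_finsetSum _ fun k _ => ?_).const_mul _
    simp_rw [← pow_mul]
    exact ((hint i _).div_const _).mul_const _
  -- The constant `1` serves the empty index type, where the product is `1` and the sum is `0`.
  refine ((integrable_const (1 : ℝ)).add
    (integrable_finsetSum Finset.univ fun i _ => hpow i (Fintype.card ι))).mono'
    (Measurable.aestronglyMeasurable (by fun_prop)) ?_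
  filter_upwards [hpos] with ω hω
  have hb : ∀ i, 0 ≤ C * (1 + (V i ω / s i) ^ N) := fun i => by
    have := hω i; have := hs i; positivity
  rw [Real.norm_of_nonneg (Finset.prod_nonneg fun i _ => hb i)]
  simp only [Pi.add_apply]
  rcases isEmpty_or_nonempty ι with hι | hι
  · simp
  · obtain ⟨j, -, hj⟩ := Finset.exists_max_image Finset.univ
      (fun i => C * (1 + (V i ω / s i) ^ N)) Finset.univ_nonempty
    calc ∏ i, (C * (1 + (V i ω / s i) ^ N)) ≤ ∏ _i : ι, (C * (1 + (V j ω / s j) ^ N)) :=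
          Finset.prod_le_prod (fun i _ => hb i) fun i hi => hj i hi
      _ = (C * (1 + (V j ω / s j) ^ N)) ^ Fintype.card ι := by simp
      _ ≤ ∑ i, (C * (1 + (V i ω / s i) ^ N)) ^ Fintype.card ι :=
          Finset.single_le_sum (f := fun i => (C * (1 + (V i ω / s i) ^ N)) ^ Fintype.card ι)
            (fun i _ => pow_nonneg (hb i) _) (Finset.mem_univ j)
      _ ≤ _ := by simp

theorem integral_prod_rpow_pos {Ω ι : Type*} [MeasurableSpace Ω] {P : Measure Ω}
    [IsProbabilityMeasure P] [Fintype ι] {V : ι → Ω → ℝ} (hV : ∀ i, Measurable (V i))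
    (hint : ∀ i (n : ℕ), Integrable (fun ω => V i ω ^ n) P)
    (hpos : ∀ᵐ ω ∂P, ∀ i, 0 < V i ω) {α : ℝ} (hα : 0 < α) :
    0 < ∫ ω, ∏ i, V i ω ^ α ∂P := by
  obtain ⟨N, hN⟩ := exists_nat_gt α
  have hp : ∀ᵐ ω ∂P, 0 < ∏ i, V i ω ^ α := by
    filter_upwards [hpos] with ω hω
    exact Finset.prod_pos fun i _ => Real.rpow_pos_of_pos (hω i) _
  have hi : Integrable (fun ω => ∏ i, V i ω ^ α) P := by
    refine (integrable_prod_one_add_pow hV hint hpos 1 one_pos N (s := fun _ => 1)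
      fun _ => one_pos).mono' (Measurable.aestronglyMeasurable (by fun_prop)) ?_
    filter_upwards [hpos, hp] with ω hω hω'
    rw [Real.norm_of_nonneg hω'.le]
    refine Finset.prod_le_prod (fun i _ => (Real.rpow_pos_of_pos (hω i) _).le) fun i _ => ?_
    rw [one_mul, div_one]
    rcases le_total (V i ω) 1 with h | h
    · have := Real.rpow_le_one (hω i).le h hα.le
      have := pow_pos (hω i) N
      linarith
    · have := Real.rpow_le_rpow_of_exponent_le h hN.le
      rw [Real.rpow_natCast] at this
      linarith
  rw [integral_pos_iff_support_of_nonneg_ae (hp.mono fun _ h => h.le) hi]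
  have : P (Function.support fun ω => ∏ i, V i ω ^ α) = 1 :=
    (prob_compl_eq_zero_iff₀ (by
      exact hi.aemeasurable.nullMeasurable (measurableSet_singleton 0).compl)).1 (by
        refine measure_mono_null ?_ hp
        intro ω hω hω'
        exact hω fun h => hω'.ne' h)
  rw [this]
  exact one_pos

/-- Dominated convergence: the Potter bound with `y = V i / s i` controls each factor uniformly in
large `x`, and no independence among the `V i` is needed. -/
theorem tendsto_integral_prod_tail {Ω ι : Type*} [MeasurableSpace Ω] {P : Measure Ω}
    [IsProbabilityMeasure P] [Fintype ι] {V : ι → Ω → ℝ} (hV : ∀ i, Measurable (V i))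
    (hint : ∀ i (n : ℕ), Integrable (fun ω => V i ω ^ n) P)
    (hpos : ∀ᵐ ω ∂P, ∀ i, 0 < V i ω) {α : ℝ}
    {G : ℝ → ℝ} (hanti : Antitone G) (hG : ∀ x, 0 < G x) (hle : ∀ x, G x ≤ 1)
    (hreg : ∀ s, 0 < s → Tendsto (fun x => G (s * x) / G x) atTop (𝓝 (s ^ (-α))))
    {s : ι → ℝ} (hs : ∀ i, 0 < s i) :
    Tendsto (fun x => (∫ ω, ∏ i, G (x * s i / V i ω) ∂P) / G x ^ Fintype.card ι) atTop
      (𝓝 ((∏ i, s i ^ (-α)) * ∫ ω, ∏ i, V i ω ^ α ∂P)) := by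
  obtain ⟨N, C, x₀, hC, hx₀, hbound⟩ := exists_potter_bound hanti hG hle (hreg 2 two_pos)
  have hlhs : ∀ x, (∫ ω, ∏ i, G (x * s i / V i ω) ∂P) / G x ^ Fintype.card ι =
      ∫ ω, ∏ i, (G (x * s i / V i ω) / G x) ∂P := by
    intro x
    rw [← integral_div]
    simp_rw [Finset.prod_div_distrib, Finset.prod_const, Finset.card_univ]
  have hrhs : (∏ i, s i ^ (-α)) * ∫ ω, ∏ i, V i ω ^ α ∂P =
      ∫ ω, ∏ i, (s i / V i ω) ^ (-α) ∂P := by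
    rw [← integral_const_mul]
    refine integral_congr_ae ?_
    filter_upwards [hpos] with ω hω
    rw [← Finset.prod_mul_distrib]
    refine Finset.prod_congr rfl fun i _ => ?_
    rw [Real.div_rpow (hs i).le (hω i).le, Real.rpow_neg (hω i).le, div_inv_eq_mul]
  simp_rw [hlhs, hrhs]
  have hGm : Measurable G := hanti.measurable
  refine tendsto_integral_filter_of_dominated_convergence
    (fun ω => ∏ i, (C * (1 + (V i ω / s i) ^ N)))
    (Eventually.of_forall fun x => Measurable.aestronglyMeasurable (by fun_prop)) ?_
    (integrable_prod_one_add_pow hV hint hpos C hC N hs) ?_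
  · filter_upwards [eventually_ge_atTop x₀] with x hx
    filter_upwards [hpos] with ω hω
    have hnn : ∀ i, 0 ≤ G (x * s i / V i ω) / G x := fun i => (div_pos (hG _) (hG _)).le
    rw [Real.norm_of_nonneg (Finset.prod_nonneg fun i _ => hnn i)]
    refine Finset.prod_le_prod (fun i _ => hnn i) fun i _ => ?_
    have := hbound x hx (V i ω / s i) (div_pos (hω i) (hs i))
    rwa [div_div_eq_mul_div] at this
  · filter_upwards [hpos] with ω hω
    refine tendsto_finsetProd _ fun i _ => ?_
    refine (hreg (s i / V i ω) (div_pos (hs i) (hω i))).congr fun x => ?_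
    congr 2
    ring

theorem measureReal_forall_lt_mul {Ω ι : Type*} [MeasurableSpace Ω] {P : Measure Ω}
    [IsProbabilityMeasure P] [Fintype ι] {V W : ι → Ω → ℝ} (hV : ∀ i, Measurable (V i))
    (hW : ∀ i, Measurable (W i))
    (hind : IndepFun (fun ω i => V i ω) (fun ω i => W i ω) P) (hWi : iIndepFun W P)
    (hpos : ∀ᵐ ω ∂P, ∀ i, 0 < V i ω) {G : ℝ → ℝ}
    (hG : ∀ i x, P.real {ω | x < W i ω} = G x) (c : ι → ℝ) :
    P.real {ω | ∀ i, c i < V i ω * W i ω} = ∫ ω, ∏ i, G (c i / V i ω) ∂P := by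
  have hVm : Measurable fun ω i => V i ω := measurable_pi_lambda _ hV
  have hWm : Measurable fun ω i => W i ω := measurable_pi_lambda _ hW
  set E : Set ((ι → ℝ) × (ι → ℝ)) := {q | ∀ i, c i < q.1 i * q.2 i} with hE
  have hEm : MeasurableSet E := by
    rw [hE, ofPred_forall]
    exact MeasurableSet.iInter fun i => measurableSet_lt (by fun_prop) (by fun_prop)
  have hpm : IsProbabilityMeasure (P.map fun ω i => W i ω) :=
    Measure.isProbabilityMeasure_map hWm.aemeasurable
  have h1 : P {ω | ∀ i, c i < V i ω * W i ω} =
      ∫⁻ ω, (P.map fun ω i => W i ω) (Prod.mk (fun i => V i ω) ⁻¹' E) ∂P := by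
    rw [← lintegral_map (μ := P) (f := fun y => (P.map fun ω i => W i ω) (Prod.mk y ⁻¹' E))
      (measurable_measure_prodMk_left hEm) hVm, ← Measure.prod_apply hEm,
      ← (indepFun_iff_map_prod_eq_prod_map_map hVm.aemeasurable hWm.aemeasurable).1 hind,
      Measure.map_apply (hVm.prodMk hWm) hEm]
    rfl
  have hm : Measurable fun ω => (P.map fun ω i => W i ω) (Prod.mk (fun i => V i ω) ⁻¹' E) :=
    (measurable_measure_prodMk_left hEm).comp hVm
  rw [Measure.real, h1, ← integral_toReal hm.aemeasurable
    (Eventually.of_forall fun ω => measure_lt_top _ _)]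
  refine integral_congr_ae ?_
  filter_upwards [hpos] with ω hω
  have hset : Prod.mk (fun i => V i ω) ⁻¹' E = univ.pi fun i => Ioi (c i / V i ω) := by
    ext y
    simp only [hE, mem_preimage, mem_ofPred_eq, mem_univ_pi, mem_Ioi]
    exact forall_congr' fun i => (div_lt_iff₀' (hω i)).symm
  have hprob : ∀ i, IsProbabilityMeasure (P.map (W i)) := fun i =>
    Measure.isProbabilityMeasure_map (hW i).aemeasurable
  rw [hset, (iIndepFun_iff_map_fun_eq_pi_map fun i => (hW i).aemeasurable).1 hWi, Measure.pi_pi,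
    ENNReal.toReal_prod]
  refine Finset.prod_congr rfl fun i _ => ?_
  rw [← hG i, Measure.map_apply (hW i) measurableSet_Ioi]
  rfl

/-! ### Almost sure limits of Gaussian variables -/

/-- The parameters are chosen before the noise sequence, so one pair serves every time shift; this
is what makes the volatilities identically distributed. -/
theorem exists_map_sum_mul_eq_gaussianReal {a : ℕ → ℝ} {m : ℝ} {v : NNReal} (n : ℕ) :
    ∃ (M : ℝ) (w : NNReal), ∀ {Ω : Type*} [MeasurableSpace Ω] {P : Measure Ω}
      [IsProbabilityMeasure P] {η : ℕ → Ω → ℝ}, (∀ i, Measurable (η i)) → iIndepFun η P →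
      (∀ i, P.map (η i) = gaussianReal m v) →
      P.map (fun ω => ∑ i ∈ Finset.range n, a i * η i ω) = gaussianReal M w := by
  induction n with
  | zero =>
    refine ⟨0, 0, fun {Ω} _ {P} _ {η} _ _ _ => ?_⟩
    simp
  | succ n ih =>
    obtain ⟨M, w, h⟩ := ih
    refine ⟨M + a n * m, w + .mk (a n ^ 2) (sq_nonneg _) * v,
      fun {Ω} _ {P} _ {η} hη hind hlaw => ?_⟩
    have hterm : P.map (fun ω => a n * η n ω) =
        gaussianReal (a n * m) (.mk (a n ^ 2) (sq_nonneg _) * v) :=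
      (gaussianReal_const_mul ⟨(hη n).aemeasurable, hlaw n⟩ (a n)).map_eq
    have hi : iIndepFun (fun i ω => a i * η i ω) P :=
      hind.comp (fun i x => a i * x) fun i => measurable_const_mul _
    have hsum := hi.indepFun_finsetSum_of_notMem (fun i => (hη i).const_mul (a i))
      (s := Finset.range n) (i := n) (by simp)
    have heq : (∑ i ∈ Finset.range n, fun ω => a i * η i ω) =
        fun ω => ∑ i ∈ Finset.range n, a i * η i ω := by
      ext ω; simp
    rw [heq] at hsum
    rw [← gaussianReal_add_gaussianReal_of_indepFun hsum (h hη hind hlaw) hterm]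
    congr 1
    ext ω
    simp [Finset.sum_range_succ]

theorem tendsto_charFun_map_of_ae_tendsto {Ω : Type*} [MeasurableSpace Ω] {P : Measure Ω}
    [IsProbabilityMeasure P] {Y : ℕ → Ω → ℝ} {Z : Ω → ℝ} (hY : ∀ n, Measurable (Y n))
    (hZ : Measurable Z) (hlim : ∀ᵐ ω ∂P, Tendsto (fun n => Y n ω) atTop (𝓝 (Z ω))) (t : ℝ) :
    Tendsto (fun n => charFun (P.map (Y n)) t) atTop (𝓝 (charFun (P.map Z) t)) := by
  have hcf : ∀ U : Ω → ℝ, Measurable U →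
      charFun (P.map U) t = ∫ ω, Complex.exp (t * U ω * Complex.I) ∂P := by
    intro U hU
    rw [charFun_apply_real, integral_map hU.aemeasurable]
    exact Measurable.aestronglyMeasurable (by fun_prop)
  simp_rw [hcf Z hZ, fun n => hcf (Y n) (hY n)]
  refine tendsto_integral_of_dominated_convergence (fun _ => 1)
    (fun n => Measurable.aestronglyMeasurable ?_) (integrable_const _)
    (fun n => Eventually.of_forall fun ω => ?_) ?_
  · have := hY n
    fun_prop
  · rw [← Complex.ofReal_mul, Complex.norm_exp_ofReal_mul_I]
  · filter_upwards [hlim] with ω hω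
    have hc : Continuous fun u : ℝ => Complex.exp (t * u * Complex.I) := by fun_prop
    exact (hc.tendsto _).comp hω

theorem map_eq_of_ae_tendsto {Ω : Type*} [MeasurableSpace Ω] {P : Measure Ω}
    [IsProbabilityMeasure P] {Y Y' : ℕ → Ω → ℝ} {Z Z' : Ω → ℝ} (hY : ∀ n, Measurable (Y n))
    (hY' : ∀ n, Measurable (Y' n)) (hZ : Measurable Z) (hZ' : Measurable Z')
    (hlaw : ∀ n, P.map (Y n) = P.map (Y' n))
    (hlim : ∀ᵐ ω ∂P, Tendsto (fun n => Y n ω) atTop (𝓝 (Z ω)))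
    (hlim' : ∀ᵐ ω ∂P, Tendsto (fun n => Y' n ω) atTop (𝓝 (Z' ω))) :
    P.map Z = P.map Z' := by
  have := Measure.isProbabilityMeasure_map (μ := P) hZ.aemeasurable
  have := Measure.isProbabilityMeasure_map (μ := P) hZ'.aemeasurable
  refine Measure.ext_of_charFun (funext fun t => ?_)
  refine tendsto_nhds_unique (tendsto_charFun_map_of_ae_tendsto hY hZ hlim t) ?_
  simp_rw [hlaw]
  exact tendsto_charFun_map_of_ae_tendsto hY' hZ' hlim' t

/-- The limit characteristic function is continuous with value `1` at `0`, so its modulus exceeds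
`1/2` at some `t ≠ 0`. Eventually `exp (-w n * t ^ 2 / 2) > 1/2`, which bounds `w n`. -/
theorem exists_variance_bound_of_ae_tendsto {Ω : Type*} [MeasurableSpace Ω] {P : Measure Ω}
    [IsProbabilityMeasure P] {Y : ℕ → Ω → ℝ} {Z : Ω → ℝ} (hY : ∀ n, Measurable (Y n))
    (hZ : Measurable Z) {M : ℕ → ℝ} {w : ℕ → NNReal}
    (hlaw : ∀ n, P.map (Y n) = gaussianReal (M n) (w n))
    (hlim : ∀ᵐ ω ∂P, Tendsto (fun n => Y n ω) atTop (𝓝 (Z ω))) :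
    ∃ B : ℝ, ∀ᶠ n in atTop, (w n : ℝ) ≤ B := by
  have hpm := Measure.isProbabilityMeasure_map (μ := P) hZ.aemeasurable
  have hcont : Tendsto (fun t => ‖charFun (P.map Z) t‖) (𝓝[≠] 0) (𝓝 1) := by
    have h0 : ‖charFun (P.map Z) 0‖ = 1 := by simp [charFun_zero]
    rw [← h0]
    exact (continuous_charFun.norm.tendsto 0).mono_left nhdsWithin_le_nhds
  obtain ⟨t, ht, ht0⟩ := ((hcont.eventually_const_lt (u := 1 / 2) (by norm_num)).and
    self_mem_nhdsWithin).exists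
  have ht2 : 0 < t ^ 2 := by
    have : t ≠ 0 := ht0
    positivity
  refine ⟨2 * Real.log 2 / t ^ 2, ?_⟩
  filter_upwards [((tendsto_charFun_map_of_ae_tendsto hY hZ hlim t).norm).eventually_const_lt ht]
    with n hn
  rw [hlaw, charFun_gaussianReal, Complex.norm_exp] at hn
  have hre : ((t : ℂ) * (M n) * Complex.I - (w n : ℝ) * (t : ℂ) ^ 2 / 2).re =
      -(w n * t ^ 2 / 2) := by
    rw [← Complex.ofReal_pow, ← Complex.ofReal_mul, ← Complex.ofReal_mul]
    have h2 : ((w n : ℝ) * t ^ 2 : ℝ) / (2 : ℂ) = (((w n : ℝ) * t ^ 2 / 2 : ℝ) : ℂ) := by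
      push_cast; ring
    rw [h2, Complex.sub_re, Complex.re_ofReal_mul, Complex.ofReal_re]
    simp
  rw [hre, ← Real.log_lt_iff_lt_exp (by norm_num), one_div, Real.log_inv] at hn
  rw [le_div_iff₀ ht2]
  linarith

/-- By Fatou, `liminf (Y n - M n) ^ 2` is almost surely finite. At one such point where `Y n` also
converges, infinitely many `M n` stay within a fixed distance of a bounded sequence. -/
theorem exists_frequently_mean_bound_of_ae_tendsto {Ω : Type*} [MeasurableSpace Ω] {P : Measure Ω}
    [IsProbabilityMeasure P] {Y : ℕ → Ω → ℝ} {Z : Ω → ℝ} (hY : ∀ n, Measurable (Y n))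
    {M : ℕ → ℝ} {w : ℕ → NNReal}
    (hlaw : ∀ n, P.map (Y n) = gaussianReal (M n) (w n))
    (hlim : ∀ᵐ ω ∂P, Tendsto (fun n => Y n ω) atTop (𝓝 (Z ω)))
    {B : ℝ} (hB : ∀ᶠ n in atTop, (w n : ℝ) ≤ B) :
    ∃ K : ℝ, ∃ᶠ n in atTop, |M n| ≤ K := by
  have hsq : ∀ n, ∫⁻ ω, ENNReal.ofReal ((Y n ω - M n) ^ 2) ∂P = w n := by
    intro n
    have hm : Measurable fun x : ℝ => ENNReal.ofReal ((x - M n) ^ 2) := by fun_prop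
    rw [← lintegral_map hm (hY n), hlaw n]
    have hv := variance_fun_id_gaussianReal (μ := M n) (v := w n)
    have hL : MemLp (fun x : ℝ => x) 2 (gaussianReal (M n) (w n)) := memLp_id_gaussianReal 2
    have he := ofReal_variance hL
    rw [hv, evariance_eq_lintegral_ofReal, integral_id_gaussianReal] at he
    rw [← he]
    simp
  have hfat : ∫⁻ ω, liminf (fun n => ENNReal.ofReal ((Y n ω - M n) ^ 2)) atTop ∂P ≠ ⊤ := by
    refine ne_top_of_le_ne_top ENNReal.ofReal_ne_top (b := ENNReal.ofReal B) ?_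
    refine (lintegral_liminf_le fun n => by have := hY n; fun_prop).trans ?_
    simp_rw [hsq]
    refine liminf_le_of_frequently_le' (hB.mono fun n hn => ?_).frequently
    rw [← ENNReal.ofReal_coe_nnreal]
    exact ENNReal.ofReal_le_ofReal hn
  have hlt := ae_lt_top (Measurable.liminf fun n => by have := hY n; fun_prop) hfat
  obtain ⟨ω, hω, hω'⟩ := (hlt.and hlim).exists
  obtain ⟨c, hc, hc'⟩ := exists_between hω
  have hfr := frequently_lt_of_liminf_lt (by isBoundedDefault) hc
  refine ⟨|Z ω| + 1 + (c.toReal + 1), ?_⟩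
  have hbd : ∀ᶠ n in atTop, |Y n ω| < |Z ω| + 1 :=
    hω'.abs.eventually_lt_const (by linarith)
  refine (hfr.and_eventually hbd).mono fun n hn => ?_
  have h1 : (Y n ω - M n) ^ 2 < c.toReal := by
    rw [← ENNReal.ofReal_lt_iff_lt_toReal (sq_nonneg _) hc'.ne]
    exact hn.1
  have h2 : |Y n ω - M n| ≤ c.toReal + 1 := by
    rw [← sq_abs] at h1
    nlinarith [abs_nonneg (Y n ω - M n), sq_nonneg (|Y n ω - M n| - 1)]
  have h3 : |M n| ≤ |Y n ω| + |Y n ω - M n| := by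
    have := abs_sub (Y n ω) (Y n ω - M n)
    simpa using this
  linarith [hn.2]

/-- Almost sure limits of Gaussian variables have all exponential moments. -/
theorem integrable_exp_mul_of_ae_tendsto_gaussian {Ω : Type*} [MeasurableSpace Ω] {P : Measure Ω}
    [IsProbabilityMeasure P] {Y : ℕ → Ω → ℝ} {Z : Ω → ℝ} (hY : ∀ n, Measurable (Y n))
    (hZ : Measurable Z) {M : ℕ → ℝ} {w : ℕ → NNReal}
    (hlaw : ∀ n, P.map (Y n) = gaussianReal (M n) (w n))
    (hlim : ∀ᵐ ω ∂P, Tendsto (fun n => Y n ω) atTop (𝓝 (Z ω))) (r : ℝ) :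
    Integrable (fun ω => Real.exp (r * Z ω)) P := by
  obtain ⟨B, hB⟩ := exists_variance_bound_of_ae_tendsto hY hZ hlaw hlim
  obtain ⟨K, hK⟩ := exists_frequently_mean_bound_of_ae_tendsto hY hlaw hlim hB
  have hexp : ∀ n, ∫⁻ ω, ENNReal.ofReal (Real.exp (r * Y n ω)) ∂P =
      ENNReal.ofReal (Real.exp (M n * r + w n * r ^ 2 / 2)) := by
    intro n
    have hi : Integrable (fun ω => Real.exp (r * Y n ω)) P := by
      have := integrable_exp_mul_gaussianReal (μ := M n) (v := w n) r
      rw [← hlaw n] at this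
      exact (integrable_map_measure (Measurable.aestronglyMeasurable (by fun_prop))
        (hY n).aemeasurable).1 this
    rw [← ofReal_integral_eq_lintegral_ofReal hi
      (Eventually.of_forall fun ω => (Real.exp_pos _).le), ← mgf_gaussianReal (hlaw n) r]
    rfl
  refine ⟨Measurable.aestronglyMeasurable (by fun_prop), ?_⟩
  rw [hasFiniteIntegral_iff_ofReal (Eventually.of_forall fun ω => (Real.exp_pos _).le)]
  have h1 : ∫⁻ ω, ENNReal.ofReal (Real.exp (r * Z ω)) ∂P =
      ∫⁻ ω, liminf (fun n => ENNReal.ofReal (Real.exp (r * Y n ω))) atTop ∂P := by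
    refine lintegral_congr_ae ?_
    filter_upwards [hlim] with ω hω
    refine (Tendsto.liminf_eq ?_).symm
    exact ENNReal.tendsto_ofReal
      ((Real.continuous_exp.tendsto _).comp (hω.const_mul r))
  rw [h1]
  refine (lintegral_liminf_le fun n => by have := hY n; fun_prop).trans_lt ?_
  simp_rw [hexp]
  -- A liminf needs a bound for infinitely many `n` only, which is all that is known about the
  -- means.
  refine lt_of_le_of_lt (liminf_le_of_frequently_le' (x := ENNReal.ofReal
    (Real.exp (K * |r| + B * r ^ 2 / 2))) ?_) ENNReal.ofReal_lt_top
  refine (hK.and_eventually hB).mono fun n hn => ?_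
  refine ENNReal.ofReal_le_ofReal (Real.exp_le_exp.2 ?_)
  have h2 : M n * r ≤ K * |r| := by
    calc M n * r ≤ |M n * r| := le_abs_self _
      _ = |M n| * |r| := abs_mul _ _
      _ ≤ K * |r| := by gcongr; exact hn.1
  have h3 : (w n : ℝ) * r ^ 2 ≤ B * r ^ 2 := by gcongr; exact hn.2
  linarith

/-! ### Quantile functions of regularly varying laws -/

theorem cdf_set_nonempty (μ : Measure ℝ) {u : ℝ} (hu : u < 1) : {x : ℝ | u ≤ cdf μ x}.Nonempty :=
  ((tendsto_cdf_atTop μ).eventually_const_le hu).exists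

theorem cdf_set_bddBelow (μ : Measure ℝ) {u : ℝ} (hu : 0 < u) : BddBelow {x : ℝ | u ≤ cdf μ x} := by
  obtain ⟨b, hb⟩ := ((tendsto_cdf_atBot μ).eventually_lt_const hu).exists
  refine ⟨b, fun y hy => ?_⟩
  by_contra! hlt
  exact absurd (hy.trans (monotone_cdf μ hlt.le)) (not_le.2 hb)

theorem le_cdf_quantileFun (μ : Measure ℝ) {u : ℝ} (hu : u < 1) : u ≤ cdf μ (quantileFun μ u) := by
  have hc : Tendsto (cdf μ) (𝓝[>] (quantileFun μ u)) (𝓝 (cdf μ (quantileFun μ u))) :=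
    ((cdf μ).right_continuous _).mono_left (nhdsWithin_mono _ Ioi_subset_Ici_self)
  refine ge_of_tendsto hc ?_
  filter_upwards [self_mem_nhdsWithin] with y hy
  obtain ⟨z, hz, hzy⟩ := exists_lt_of_csInf_lt (cdf_set_nonempty μ hu) hy
  exact le_trans hz (monotone_cdf μ hzy.le)

theorem cdf_lt_of_lt_quantileFun (μ : Measure ℝ) {u y : ℝ} (hu : 0 < u)
    (hy : y < quantileFun μ u) : cdf μ y < u :=
  not_le.1 fun h => absurd (csInf_le (cdf_set_bddBelow μ hu) h) (not_le.2 hy)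

theorem quantileFun_mono (μ : Measure ℝ) {u u' : ℝ} (hu : 0 < u) (huu' : u ≤ u') (hu' : u' < 1) :
    quantileFun μ u ≤ quantileFun μ u' :=
  csInf_le_csInf (cdf_set_bddBelow μ hu) (cdf_set_nonempty μ hu') fun _ hy => huu'.trans hy

theorem measureReal_Ioi_eq (μ : Measure ℝ) [IsProbabilityMeasure μ] (x : ℝ) :
    μ.real (Ioi x) = 1 - cdf μ x := by
  rw [cdf_eq_real, ← compl_Iic, probReal_compl_eq_one_sub measurableSet_Iic]

theorem one_sub_one_div_mem {x : ℝ} (hx : 1 < x) : 0 < 1 - 1 / x ∧ 1 - 1 / x < 1 := by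
  have h1 : 1 / x < 1 := by rw [div_lt_one (by linarith)]; exact hx
  have h2 : 0 < 1 / x := by positivity
  constructor <;> linarith

theorem tendsto_quantileFun_atTop (μ : Measure ℝ) [IsProbabilityMeasure μ]
    (hpos : ∀ x, 0 < μ.real (Ioi x)) :
    Tendsto (fun x => quantileFun μ (1 - 1 / x)) atTop atTop := by
  refine tendsto_atTop.2 fun b => ?_
  have h0 : Tendsto (fun x : ℝ => 1 / x) atTop (𝓝 0) := by
    simpa using tendsto_inv_atTop_zero
  filter_upwards [h0.eventually_lt_const (hpos b), eventually_gt_atTop 1] with x hx hx1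
  have h1 := le_cdf_quantileFun μ (one_sub_one_div_mem hx1).2
  by_contra! hlt
  have h2 := monotone_cdf μ hlt.le
  rw [measureReal_Ioi_eq] at hx
  linarith

/-- With `q` the quantile, right continuity gives tail at most `1/x` at `q`. A jump could make it
smaller, but at `r * q` with `r < 1` the tail exceeds `1/x`, and regular variation compares the two
points with a ratio tending to `r ^ α`; `r` is taken close to `1`. -/
theorem tendsto_mul_tail_quantileFun (μ : Measure ℝ) [IsProbabilityMeasure μ]
    (hpos : ∀ x, 0 < μ.real (Ioi x)) {α : ℝ}
    (hreg : ∀ s, 0 < s →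
      Tendsto (fun x => μ.real (Ioi (x * s)) / μ.real (Ioi x)) atTop (𝓝 (s ^ (-α)))) :
    Tendsto (fun x => x * μ.real (Ioi (quantileFun μ (1 - 1 / x)))) atTop (𝓝 1) := by
  have hq := tendsto_quantileFun_atTop μ hpos
  refine tendsto_order.2 ⟨fun b hb => ?_, fun b hb => ?_⟩
  · have hcont : Tendsto (fun r : ℝ => (r ^ (-α))⁻¹) (𝓝[<] 1) (𝓝 1) := by
      have h : ContinuousAt (fun r : ℝ => (r ^ (-α))⁻¹) 1 :=
        (Real.continuousAt_rpow_const 1 (-α) (Or.inl one_ne_zero)).inv₀ (by simp)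
      have h' := h.tendsto
      simp only [Real.one_rpow, inv_one] at h'
      exact h'.mono_left nhdsWithin_le_nhds
    obtain ⟨r, hrb, hr1, hr0⟩ := ((hcont.eventually_const_lt hb).and
      ((eventually_mem_nhdsWithin).and
        (nhdsWithin_le_nhds (Ioi_mem_nhds (zero_lt_one (α := ℝ)))))).exists
    have hr0' : 0 < r := hr0
    have hr1' : r < 1 := hr1
    have hlim := ((hreg r hr0').comp hq).inv₀ (Real.rpow_pos_of_pos hr0' _).ne'
    filter_upwards [hlim.eventually_const_lt hrb, hq.eventually_gt_atTop 0,
      eventually_gt_atTop 1] with x hx hqx hx1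
    refine hx.trans ?_
    have hlt := cdf_lt_of_lt_quantileFun μ (one_sub_one_div_mem hx1).1
      (mul_lt_of_lt_one_right hqx hr1')
    have hx0 : 0 < x := by linarith
    have h1 : 1 < x * μ.real (Ioi (quantileFun μ (1 - 1 / x) * r)) := by
      rw [measureReal_Ioi_eq, ← div_lt_iff₀' hx0]
      linarith
    simp only [Function.comp_apply]
    rw [inv_div, div_lt_iff₀ (hpos _), mul_right_comm]
    exact lt_mul_of_one_lt_left (hpos _) h1
  · filter_upwards [eventually_gt_atTop 1] with x hx1
    have h1 := le_cdf_quantileFun μ (one_sub_one_div_mem hx1).2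
    have hx0 : 0 < x := by linarith
    refine lt_of_le_of_lt ?_ hb
    rw [measureReal_Ioi_eq, ← le_div_iff₀' hx0]
    linarith

theorem isRegVaryingAtTop_comp_quantileFun (μ : Measure ℝ) [IsProbabilityMeasure μ]
    (hpos : ∀ x, 0 < μ.real (Ioi x)) {α : ℝ}
    (hreg : ∀ s, 0 < s →
      Tendsto (fun x => μ.real (Ioi (x * s)) / μ.real (Ioi x)) atTop (𝓝 (s ^ (-α))))
    {J : ℝ → ℝ} (hJ : Antitone J) (hJpos : ∀ x, 0 < J x) {K : ℝ} (hK : 0 < K)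
    (hlim : Tendsto (fun x => J x / μ.real (Ioi x) ^ 2) atTop (𝓝 K)) :
    IsRegVaryingAtTop (fun x => J (quantileFun μ (1 - 1 / x))) (-2) := by
  have hq := tendsto_quantileFun_atTop μ hpos
  -- For `x > 1` the level `1 - 1/x` lies in `(0, 1)`, where the quantile function is monotone;
  -- outside, `sInf` may take its default value.
  refine ⟨⟨1, fun x _ => hJpos _, Antitone.measurable fun x y hxy => hJ ?_⟩, fun s hs => ?_⟩
  · refine quantileFun_mono μ (one_sub_one_div_mem x.2).1 ?_ (one_sub_one_div_mem y.2).2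
    have hx : (0 : ℝ) < x := lt_trans one_pos x.2
    have hxy' : (x : ℝ) ≤ y := hxy
    gcongr
  · have hmain : Tendsto (fun x => x ^ 2 * J (quantileFun μ (1 - 1 / x))) atTop (𝓝 K) := by
      have h := (hlim.comp hq).mul ((tendsto_mul_tail_quantileFun μ hpos hreg).pow 2)
      rw [one_pow, mul_one] at h
      refine h.congr fun x => ?_
      have := (hpos (quantileFun μ (1 - 1 / x))).ne'
      simp only [Function.comp_apply]
      field_simp
    have hs' : Tendsto (fun x => s * x) atTop atTop := tendsto_id.const_mul_atTop hs
    have h := ((hmain.comp hs').div hmain hK.ne').mul_const (s ^ (-2 : ℝ))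
    rw [div_self hK.ne', one_mul] at h
    refine h.congr' ?_
    filter_upwards [eventually_gt_atTop 0] with x hx
    have := (hJpos (quantileFun μ (1 - 1 / x))).ne'
    simp only [Function.comp_apply, Pi.div_apply]
    rw [Real.rpow_neg hs.le, Real.rpow_two]
    field_simp

/-! ### The stochastic volatility model -/

namespace IsClassicalSVModel

variable {Ω : Type*} [MeasurableSpace Ω] {P : Measure Ω} {X σ ε η : ℤ → Ω → ℝ} {a : ℕ → ℝ} {m : ℝ} {v : NNReal} {α p : ℝ}

theorem measurable_returns (hX : IsClassicalSVModel P X σ ε η a m v α p) (t : ℤ) :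
    Measurable (X t) := by
  have : X t = fun ω => σ t ω * ε t ω := funext fun ω => hX.returns_eq t ω
  rw [this]
  exact (hX.measurable_vol t).mul (hX.measurable_innov t)

theorem innov_tail_eq (hX : IsClassicalSVModel P X σ ε η a m v α p) (t : ℤ) (x : ℝ) :
    P.real {ω | x < ε t ω} = P.real {ω | x < ε 0 ω} :=
  congrArg ENNReal.toReal ((hX.innov_identDistrib t).measure_mem_eq (measurableSet_Ioi (a := x)))

theorem noise_shift_indep (hX : IsClassicalSVModel P X σ ε η a m v α p) (t : ℤ) :
    iIndepFun (fun i : ℕ => η (t - (i : ℤ))) P :=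
  hX.noise_indep.precomp (g := fun i : ℕ => t - (i : ℤ)) fun i j hij => by
    simpa using hij

theorem measurable_partial_sum (hX : IsClassicalSVModel P X σ ε η a m v α p) (t : ℤ) (n : ℕ) :
    Measurable fun ω => ∑ i ∈ Finset.range n, a i * η (t - (i : ℤ)) ω :=
  Finset.measurable_fun_sum _ fun _ _ => (hX.measurable_noise _).const_mul _

theorem vol_indep_innov (hX : IsClassicalSVModel P X σ ε η a m v α p) {ι : Type*} [Finite ι]
    (t : ι → ℤ) : IndepFun (fun ω i => σ (t i) ω) (fun ω i => ε (t i) ω) P := by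
  have := Fintype.ofFinite ι
  -- The limsup is a measurable function of the noise defined everywhere; it agrees with the limit,
  -- and its exponential with `σ`, almost surely.
  have hφ : Measurable fun (e : ℤ → ℝ) (i : ι) => Real.exp (limsup (fun n : ℕ =>
      ∑ k ∈ Finset.range n, a k * e (t i - (k : ℤ))) atTop) :=
    measurable_pi_lambda _ fun i => Real.measurable_exp.comp
      (Measurable.limsup fun n => by fun_prop)
  have hψ : Measurable fun (e : ℤ → ℝ) (i : ι) => e (t i) :=
    measurable_pi_lambda _ fun i => measurable_pi_apply _
  refine (hX.innov_indep_noise.symm.comp hφ hψ).congr ?_ (ae_eq_refl _)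
  have h1 : ∀ᵐ ω ∂P, ∀ i, 0 < σ (t i) ω := ae_all_iff.2 fun i => hX.vol_pos (t i)
  have h2 := ae_all_iff.2 fun i => hX.log_vol (t i)
  filter_upwards [h1, h2] with ω hω1 hω2
  ext i
  simp only [Function.comp_apply]
  rw [(hω2 i).limsup_eq, Real.exp_log (hω1 i)]

/-- Lets marginal tails be treated as joint tails over a one-point index type. -/
theorem map_Ioi_eq (hX : IsClassicalSVModel P X σ ε η a m v α p) (t : ℤ) (x : ℝ) :
    (P.map (X t)).real (Ioi x) = P.real {ω | ∀ _ : Unit, x < X t ω} := by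
  rw [map_measureReal_apply (hX.measurable_returns t) measurableSet_Ioi]
  congr 1
  ext ω
  simp

variable [IsProbabilityMeasure P]

theorem innov_tail_antitone : Antitone fun x => P.real {ω | x < ε 0 ω} := fun _ _ hxy =>
  measureReal_mono fun _ hω => lt_of_le_of_lt hxy hω

/-- A ratio with positive limit `p` has a nonzero numerator at arbitrarily large arguments, and the
tail is antitone. -/
theorem innov_tail_pos (hX : IsClassicalSVModel P X σ ε η a m v α p) (hp : 0 < p) (x : ℝ) :
    0 < P.real {ω | x < ε 0 ω} := by
  have h := hX.right_tail 0 1 one_pos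
  rw [Real.one_rpow, mul_one] at h
  obtain ⟨y, hy, hxy⟩ := ((h.eventually_const_lt hp).and (eventually_ge_atTop x)).exists
  rw [one_mul] at hy
  have hne : P.real {ω | y < ε 0 ω} ≠ 0 := fun h0 => by simp [h0] at hy
  exact (measureReal_nonneg.lt_of_ne' hne).trans_le (innov_tail_antitone hxy)

theorem innov_tail_regVarying (hX : IsClassicalSVModel P X σ ε η a m v α p) (hp : 0 < p)
    {s : ℝ} (hs : 0 < s) :
    Tendsto (fun x => P.real {ω | s * x < ε 0 ω} / P.real {ω | x < ε 0 ω}) atTop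
      (𝓝 (s ^ (-α))) := by
  have h1 := hX.right_tail 0 1 one_pos
  rw [Real.one_rpow, mul_one] at h1
  have h := (hX.right_tail 0 s hs).div h1 hp.ne'
  rw [mul_div_cancel_left₀ _ hp.ne'] at h
  refine h.congr fun x => ?_
  have hpos : 0 < P.real {ω | x < |ε 0 ω|} :=
    (innov_tail_pos hX hp x).trans_le (measureReal_mono fun ω (hω : x < ε 0 ω) =>
      show x < |ε 0 ω| from hω.trans_le (le_abs_self _))
  simp only [Pi.div_apply, one_mul]
  rw [div_div_div_cancel_right₀ hpos.ne']

theorem vol_pow_integrable (hX : IsClassicalSVModel P X σ ε η a m v α p) (t : ℤ) (n : ℕ) :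
    Integrable (fun ω => σ t ω ^ n) P := by
  choose M w h using fun n => exists_map_sum_mul_eq_gaussianReal (a := a) (m := m) (v := v) n
  have hi := integrable_exp_mul_of_ae_tendsto_gaussian (hX.measurable_partial_sum t)
    (hX.measurable_vol t).log
    (fun n => h n (fun i => hX.measurable_noise _) (hX.noise_shift_indep t)
      fun i => hX.noise_law _) (hX.log_vol t) n
  refine hi.congr ?_
  filter_upwards [hX.vol_pos t] with ω hω
  rw [Real.exp_nat_mul, Real.exp_log hω]

theorem vol_identDistrib (hX : IsClassicalSVModel P X σ ε η a m v α p) (t t' : ℤ) :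
    IdentDistrib (σ t) (σ t') P P := by
  have hlog : P.map (fun ω => Real.log (σ t ω)) = P.map (fun ω => Real.log (σ t' ω)) := by
    refine map_eq_of_ae_tendsto (hX.measurable_partial_sum t) (hX.measurable_partial_sum t')
      (hX.measurable_vol t).log (hX.measurable_vol t').log (fun n => ?_) (hX.log_vol t)
      (hX.log_vol t')
    obtain ⟨M, w, h⟩ := exists_map_sum_mul_eq_gaussianReal (a := a) (m := m) (v := v) n
    rw [h (fun i => hX.measurable_noise _) (hX.noise_shift_indep t) fun i => hX.noise_law _,
      h (fun i => hX.measurable_noise _) (hX.noise_shift_indep t') fun i => hX.noise_law _]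
  have hid : IdentDistrib (fun ω => Real.log (σ t ω)) (fun ω => Real.log (σ t' ω)) P P :=
    ⟨(hX.measurable_vol t).log.aemeasurable, (hX.measurable_vol t').log.aemeasurable, hlog⟩
  have hexp : ∀ r, (fun ω => Real.exp (Real.log (σ r ω))) =ᵐ[P] σ r := fun r =>
    (hX.vol_pos r).mono fun ω hω => Real.exp_log hω
  have hc := hid.comp Real.measurable_exp
  exact ⟨(hX.measurable_vol t).aemeasurable, (hX.measurable_vol t').aemeasurable, by
    rw [← Measure.map_congr (hexp t), ← Measure.map_congr (hexp t')]; exact hc.map_eq⟩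

theorem returns_identDistrib (hX : IsClassicalSVModel P X σ ε η a m v α p) (t t' : ℤ) :
    IdentDistrib (X t) (X t') P P := by
  have hind : ∀ r, IndepFun (σ r) (ε r) P := fun r =>
    (hX.vol_indep_innov fun _ : Unit => r).comp (φ := fun y : Unit → ℝ => y ())
      (ψ := fun y : Unit → ℝ => y ()) (measurable_pi_apply _) (measurable_pi_apply _)
  have hε : IdentDistrib (ε t) (ε t') P P :=
    (hX.innov_identDistrib t).trans (hX.innov_identDistrib t').symm
  have h := ((hX.vol_identDistrib t t').prodMk hε (hind t) (hind t')).comp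
    (u := fun q : ℝ × ℝ => q.1 * q.2) (by fun_prop)
  have heq : ∀ r, X r = (fun q : ℝ × ℝ => q.1 * q.2) ∘ fun ω => (σ r ω, ε r ω) := fun r =>
    funext fun ω => hX.returns_eq r ω
  rw [heq t, heq t']
  exact h

/-- Joint exceedance probabilities are asymptotically proportional to the product of the tails of
the innovations. -/
theorem exists_tendsto_joint_tail (hX : IsClassicalSVModel P X σ ε η a m v α p) (hα : 0 < α)
    (hp : 0 < p) {ι : Type*} [Fintype ι] {t : ι → ℤ} (ht : Function.Injective t) :
    ∃ K : ℝ, 0 < K ∧ ∀ s : ι → ℝ, (∀ i, 0 < s i) →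
      Tendsto (fun x => P.real {ω | ∀ i, x * s i < X (t i) ω} /
        P.real {ω | x < ε 0 ω} ^ Fintype.card ι) atTop (𝓝 ((∏ i, s i ^ (-α)) * K)) := by
  have hpos : ∀ᵐ ω ∂P, ∀ i, 0 < σ (t i) ω := ae_all_iff.2 fun i => hX.vol_pos (t i)
  refine ⟨∫ ω, ∏ i, σ (t i) ω ^ α ∂P, integral_prod_rpow_pos (fun i => hX.measurable_vol (t i))
    (fun i n => hX.vol_pow_integrable (t i) n) hpos hα, fun s hs => ?_⟩
  refine (tendsto_integral_prod_tail (fun i => hX.measurable_vol (t i))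
    (fun i n => hX.vol_pow_integrable (t i) n) hpos innov_tail_antitone
    (innov_tail_pos hX hp) (fun x => measureReal_le_one)
    (fun s hs => innov_tail_regVarying hX hp hs) hs).congr fun x => ?_
  rw [← measureReal_forall_lt_mul (fun i => hX.measurable_vol (t i))
    (fun i => hX.measurable_innov (t i)) (hX.vol_indep_innov t) (hX.innov_indep.precomp ht) hpos
    (fun i x => hX.innov_tail_eq (t i) x) fun i => x * s i]
  simp_rw [hX.returns_eq]

theorem joint_tail_pos (hX : IsClassicalSVModel P X σ ε η a m v α p) (hα : 0 < α)
    (hp : 0 < p) {ι : Type*} [Fintype ι] {t : ι → ℤ} (ht : Function.Injective t) (x : ℝ) :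
    0 < P.real {ω | ∀ i, x < X (t i) ω} := by
  obtain ⟨K, hK, h⟩ := hX.exists_tendsto_joint_tail hα hp ht
  have h1 := h (fun _ => 1) fun _ => one_pos
  simp only [Real.one_rpow, Finset.prod_const_one, one_mul, mul_one] at h1
  obtain ⟨y, hy, hxy⟩ := ((h1.eventually_const_lt hK).and (eventually_ge_atTop x)).exists
  have hne : P.real {ω | ∀ i, y < X (t i) ω} ≠ 0 := fun h0 => by simp [h0] at hy
  exact (measureReal_nonneg.lt_of_ne' hne).trans_le
    (measureReal_mono fun ω hω i => lt_of_le_of_lt hxy (hω i))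

/-- The constant `K` does not depend on `s`, so it cancels together with the power of the innovation
tail. -/
theorem tendsto_joint_tail_div (hX : IsClassicalSVModel P X σ ε η a m v α p) (hα : 0 < α)
    (hp : 0 < p) {ι : Type*} [Fintype ι] {t : ι → ℤ} (ht : Function.Injective t) {s : ι → ℝ}
    (hs : ∀ i, 0 < s i) :
    Tendsto (fun x => P.real {ω | ∀ i, x * s i < X (t i) ω} / P.real {ω | ∀ i, x < X (t i) ω})
      atTop (𝓝 (∏ i, s i ^ (-α))) := by
  obtain ⟨K, hK, h⟩ := hX.exists_tendsto_joint_tail hα hp ht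
  have h1 := h (fun _ => 1) fun _ => one_pos
  simp only [Real.one_rpow, Finset.prod_const_one, one_mul, mul_one] at h1
  have h2 := (h s hs).div h1 hK.ne'
  rw [mul_div_cancel_right₀ _ hK.ne'] at h2
  refine h2.congr fun x => ?_
  rw [Pi.div_apply, div_div_div_cancel_right₀ (pow_pos (innov_tail_pos hX hp x) _).ne']

theorem map_Ioi_pos (hX : IsClassicalSVModel P X σ ε η a m v α p) (hα : 0 < α) (hp : 0 < p)
    (t : ℤ) (x : ℝ) : 0 < (P.map (X t)).real (Ioi x) := by
  rw [hX.map_Ioi_eq]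
  exact hX.joint_tail_pos hα hp (t := fun _ : Unit => t) (Function.injective_of_subsingleton _) x

theorem map_Ioi_regVarying (hX : IsClassicalSVModel P X σ ε η a m v α p) (hα : 0 < α) (hp : 0 < p)
    (t : ℤ) {s : ℝ} (hs : 0 < s) :
    Tendsto (fun x => (P.map (X t)).real (Ioi (x * s)) / (P.map (X t)).real (Ioi x)) atTop
      (𝓝 (s ^ (-α))) := by
  simp_rw [hX.map_Ioi_eq]
  simpa using hX.tendsto_joint_tail_div hα hp (t := fun _ : Unit => t)
    (Function.injective_of_subsingleton _) (s := fun _ => s) fun _ => hs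

theorem isRegVaryingOnCone (hX : IsClassicalSVModel P X σ ε η a m v α p) (hα : 0 < α)
    (hp : 0 < p) {d : ℕ} {t : Fin d → ℤ} (ht : Function.Injective t) :
    IsRegVaryingOnCone P (fun ω i => X (t i) ω) (-((d : ℝ) * α)) (coneMeasure d α) :=
  isRegVaryingOnCone_of_tendsto_pi_Ioi
    (measurable_pi_lambda _ fun i => hX.measurable_returns (t i)) hα
    (fun x => (ENNReal.toReal_pos_iff.1 (hX.joint_tail_pos hα hp ht x)).1)
    fun _ hs => hX.tendsto_joint_tail_div hα hp ht hs

/-- Under the product law orthant probabilities factor, so the limit is the product of the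
one-dimensional limits. -/
theorem isRegVaryingOnCone_pi (hX : IsClassicalSVModel P X σ ε η a m v α p) (hα : 0 < α)
    (hp : 0 < p) {d : ℕ} (t : Fin d → ℤ) :
    IsRegVaryingOnCone (Measure.pi fun i => P.map (X (t i))) (fun y : Fin d → ℝ => y)
      (-((d : ℝ) * α)) (coneMeasure d α) := by
  have hpm : ∀ i, IsProbabilityMeasure (P.map (X (t i))) := fun i =>
    Measure.isProbabilityMeasure_map (hX.measurable_returns (t i)).aemeasurable
  have hbox : ∀ c : Fin d → ℝ, (Measure.pi fun i => P.map (X (t i))).real {y | ∀ i, c i < y i} =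
      ∏ i, (P.map (X (t i))).real (Ioi (c i)) := by
    intro c
    have : {y : Fin d → ℝ | ∀ i, c i < y i} = univ.pi fun i => Ioi (c i) := by ext; simp
    rw [this, Measure.real, Measure.pi_pi, ENNReal.toReal_prod]
    rfl
  refine isRegVaryingOnCone_of_tendsto_pi_Ioi (measurable_id' (α := Fin d → ℝ)) hα (fun x => ?_) fun s hs => ?_
  · have h : 0 < (Measure.pi fun i => P.map (X (t i))).real {y | ∀ i, x < y i} := by
      rw [hbox fun _ => x]
      exact Finset.prod_pos fun i _ => hX.map_Ioi_pos hα hp (t i) x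
    exact (ENNReal.toReal_pos_iff.1 h).1
  · refine (tendsto_finsetProd _ fun i _ =>
      hX.map_Ioi_regVarying hα hp (t i) (hs i)).congr fun x => ?_
    rw [hbox fun i => x * s i, hbox fun _ => x, Finset.prod_div_distrib]

theorem hasTailDependenceCoeff (hX : IsClassicalSVModel P X σ ε η a m v α p) (hα : 0 < α)
    (hp : 0 < p) {t t' : ℤ} (htt' : t ≠ t') : HasTailDependenceCoeff P (X t) (X t') (1 / 2) := by
  refine ⟨hX.returns_identDistrib t t', ?_⟩
  have hpm : IsProbabilityMeasure (P.map (X t)) :=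
    Measure.isProbabilityMeasure_map (hX.measurable_returns t).aemeasurable
  have hinj : Function.Injective ![t, t'] := by
    intro i j hij
    fin_cases i <;> fin_cases j <;> simp_all
  have hset : ∀ x, {ω | ∀ i, x < X (![t, t'] i) ω} = {ω | x < X t ω ∧ x < X t' ω} := by
    intro x
    ext ω
    simp [Fin.forall_fin_two]
  obtain ⟨K, hK, h⟩ := hX.exists_tendsto_joint_tail hα hp hinj
  obtain ⟨K₁, hK₁, h₁⟩ := hX.exists_tendsto_joint_tail hα hp (t := fun _ : Unit => t)
    (Function.injective_of_subsingleton _)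
  have h := h (fun _ => 1) fun _ => one_pos
  have h₁ := h₁ (fun _ => 1) fun _ => one_pos
  simp only [Real.one_rpow, Finset.prod_const_one, one_mul, mul_one, hset, Fintype.card_fin]
    at h
  simp only [Real.one_rpow, Finset.prod_const_one, one_mul, mul_one, ← hX.map_Ioi_eq,
    Fintype.card_unit, pow_one] at h₁
  -- Joint and marginal tails are both compared with powers of the innovation tail, which is then
  -- eliminated.
  have hlim : Tendsto (fun x => P.real {ω | x < X t ω ∧ x < X t' ω} /
      (P.map (X t)).real (Ioi x) ^ 2) atTop (𝓝 (K / K₁ ^ 2)) := by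
    refine (h.div (h₁.pow 2) (pow_pos hK₁ 2).ne').congr fun x => ?_
    rw [Pi.div_apply, div_pow,
      div_div_div_cancel_right₀ (pow_pos (innov_tail_pos hX hp x) 2).ne']
  have hmain := isRegVaryingAtTop_comp_quantileFun (P.map (X t)) (hX.map_Ioi_pos hα hp t)
    (fun s hs => hX.map_Ioi_regVarying hα hp t hs)
    (J := fun x => P.real {ω | x < X t ω ∧ x < X t' ω})
    (fun x y hxy => measureReal_mono fun ω hω =>
      ⟨lt_of_le_of_lt hxy hω.1, lt_of_le_of_lt hxy hω.2⟩)
    (fun x => by rw [← hset]; exact hX.joint_tail_pos hα hp hinj x)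
    (div_pos hK (pow_pos hK₁ 2)) hlim
  have hidx : (-1 / (1 / 2) : ℝ) = -2 := by norm_num
  rw [hidx]
  exact hmain

end IsClassicalSVModel

theorem mainTheorem8 {Ω : Type*} [MeasurableSpace Ω] (P : Measure Ω) [IsProbabilityMeasure P]
    (X σ ε η : ℤ → Ω → ℝ) (a : ℕ → ℝ) (m : ℝ) (v : NNReal) (α p : ℝ)
    (hα : 0 < α) (hp : 0 < p) (hp1 : p ≤ 1)
    (hX : IsClassicalSVModel P X σ ε η a m v α p) :
    (∀ d : ℕ, 0 < d → ∀ t : Fin d → ℤ, Function.Injective t →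
      ∃ ν : Measure (Fin d → ℝ),
        IsRegVaryingOnCone P (fun ω i => X (t i) ω) (-((d : ℝ) * α)) ν ∧
        (∀ s : Fin d → ℝ, (∀ i, 0 < s i) →
          ν (Set.univ.pi fun i => Set.Ioi (s i)) = ENNReal.ofReal (∏ i, s i ^ (-α))) ∧
        IsRegVaryingOnCone (Measure.pi fun i => P.map (X (t i)))
          (fun y : Fin d → ℝ => y) (-((d : ℝ) * α)) ν) ∧
    (∀ t h : ℤ, 0 < h → HasTailDependenceCoeff P (X t) (X (t + h)) (1 / 2)) :=
  ⟨fun d _ t ht => ⟨coneMeasure d α, hX.isRegVaryingOnCone hα hp ht,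
    fun _ hs => coneMeasure_pi_Ioi hα hs, hX.isRegVaryingOnCone_pi hα hp t⟩,
    fun t h hh => hX.hasTailDependenceCoeff hα hp (by omega)⟩
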